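/- For a finite simple graph $G=(V,E)$ and a map $\mathbf p:V\to\mathbb R^d$, the rigidity matrix $\mathsf R(G,\mathbf p)\in\mathbb R^{|E|\times d|V|}$ has one row for each edge and $d$ columns for each vertex; the row of $e=\{u,v\}$ equals $\mathbf p(u)-\mathbf p(v)$ on the coordinates of $u$, $\mathbf p(v)-\mathbf p(u)$ on the coordinates of $v$, and $0$ elsewhere. A graph $G$ with at least $d+1$ vertices is called $d$-rigid if there is an injective map $\mathbf p:V\to\mathbb R^d$ such that $\operatorname{rank}\mathsf R(G,\mathbf p)=d|V|-\binom{d+1}{2}$. For an integer $k\ge 0$, a graph is $k$-connected if it has more than $k$ vertices and remains connected after the deletion of any fewer than $k$ vertices. Theorem. There exists an absolute constant $C>0$ such that for all integers $d\ge 1$ and $n\ge d+1$, every $n$-vertex graph that is $k$-connected for some integer $k\ge C d^2(\log n)^2$ (natural logarithm) is $d$-rigid. -/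

import Mathlib

/-- The rigidity matrix of the framework `(G, p)`, `p : V → ℝ^d`. Rows are indexed by the edges of
`G`, columns by `V × Fin d`. The row of the edge `{u, v}` is `p u - p v` on the coordinates of `u`,
`p v - p u` on those of `v`, and `0` elsewhere. -/
def rigidityMatrix {V : Type*} [DecidableEq V] {d : ℕ} (G : SimpleGraph V) (p : V → Fin d → ℝ) :
    Matrix G.edgeSet (V × Fin d) ℝ :=
  Matrix.of fun e x =>
    Sym2.lift ⟨fun u v =>
      if x.1 = u then p u x.2 - p v x.2 else if x.1 = v then p v x.2 - p u x.2 else 0, by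
        intro u v
        dsimp only
        by_cases h : u = v
        · subst h; rfl
        · by_cases hu : x.1 = u
          · have hv : x.1 ≠ v := fun h' => h (hu.symm.trans h')
            rw [if_pos hu, if_neg hv, if_pos hu]
          · rw [if_neg hu, if_neg hu]⟩ e.1

/-- The framework `(G, p)` is infinitesimally rigid: its rigidity matrix has rank
`d * |V| - (d + 1).choose 2` (written without subtraction). This is meant for `d + 1 ≤ |V|`. -/
def IsInfinitesimallyRigid {V : Type*} [Fintype V] [DecidableEq V] {d : ℕ} (G : SimpleGraph V)
    (p : V → Fin d → ℝ) : Prop :=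
  (rigidityMatrix G p).rank + (d + 1).choose 2 = d * Fintype.card V

/-- `G` is `d`-rigid: for some embedding `p` of its vertices into `ℝ^d`, the framework `(G, p)` is
infinitesimally rigid. -/
def IsRigidInDim {V : Type*} [Fintype V] [DecidableEq V] (d : ℕ) (G : SimpleGraph V) : Prop :=
  ∃ p : V → Fin d → ℝ, Function.Injective p ∧ IsInfinitesimallyRigid G p

/-- `G` is `k`-connected: it has more than `k` vertices, and deleting fewer than `k` vertices always
leaves a connected graph. -/
def IsVertexConnected {V : Type*} [Fintype V] (k : ℕ) (G : SimpleGraph V) : Prop :=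
  k < Fintype.card V ∧
    ∀ S : Finset V, S.card < k → (G.induce ((S : Set V)ᶜ)).Connected

/-! The logarithm plays no role: `k + 1 ≥ 3 * (d + 1) ^ 2` already suffices. Fix a generic placement
and replace `G` by its closure, adding every pair whose row lies in the row space; this changes
neither the rank nor the connectivity hypothesis. The lower bound `rank ≥ d * #S - (d + 1).choose 2`
is then proved by induction on vertex sets `S` without small cuts. A clique has enough rank by
adding its vertices one at a time. A vertex whose neighbourhood in `S` is a clique can be removed:
no small cut appears, and putting it back gains `d`.

Otherwise every `v` in `S` has two non-adjacent neighbours `x`, `y` in `S`. Insert the vertices in a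
uniformly random order. A vertex with more than `d` earlier neighbours gains at least `d`, and gains
`d + 1` if `x` and `y` are both earlier: closedness keeps the row of `xy` out of the span, so a
1-extension applies (`rigidityRank_insert_of_notMem_span`). The bonus has probability at least `1 /
3`; having at most `d` earlier neighbours has probability at most `(d + 1) / (deg v + 1)` and costs
`d + 1`. Since `deg v + 1 ≥ 3 * (d + 1) ^ 2`, the expected gain is at least `d` per vertex.

The matching upper bound comes from the infinitesimal isometries in the kernel
(`rank_rigidityMatrix_add_choose_le`). -/

/-! ### Generic points of polynomial conditions. -/

section GenericPoints

/-- Linear independence of finitely many vectors with polynomial entries is implied by the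
nonvanishing of one polynomial, which is nonzero if the vectors are independent somewhere. -/
theorem exists_polynomial_linearIndependent {σ ι κ : Type*} [Fintype ι] [Fintype κ]
    (F : ι → κ → MvPolynomial σ ℝ) :
    ∃ D : MvPolynomial σ ℝ, ∀ q : σ → ℝ,
      MvPolynomial.eval q D ≠ 0 ↔ LinearIndependent ℝ (fun i k => MvPolynomial.eval q (F i k)) := by
  classical
  -- The Gram determinant detects independence, since over the reals `A * Aᵀ` has the same rank as
  -- `A`.
  refine ⟨(Matrix.of F * (Matrix.of F).transpose).det, fun q => ?_⟩
  set A : Matrix ι κ ℝ := Matrix.of fun i k => MvPolynomial.eval q (F i k) with hA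
  have hmap : MvPolynomial.eval q (Matrix.of F * (Matrix.of F).transpose).det
      = (A * A.transpose).det := by
    rw [RingHom.map_det, RingHom.mapMatrix_apply, Matrix.map_mul]
    rfl
  rw [hmap, ← isUnit_iff_ne_zero, ← Matrix.isUnit_iff_isUnit_det]
  have hrow : LinearIndependent ℝ (fun i k => MvPolynomial.eval q (F i k)) ↔
      Fintype.card ι = A.rank := by
    rw [linearIndependent_iff_card_eq_finrank_span, A.rank_eq_finrank_span_row]
    rfl
  rw [hrow, ← Matrix.rank_self_mul_transpose]
  constructor
  · intro h
    exact (Matrix.rank_of_isUnit _ h).symm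
  · intro h
    rw [← Matrix.linearIndependent_rows_iff_isUnit, linearIndependent_iff_card_eq_finrank_span, h,
      Matrix.rank_eq_finrank_span_row]
    rfl

/-- Finitely many nonzero polynomials have a common point at which none of them vanishes. -/
theorem exists_common_eval_ne_zero {σ J : Type*} [Finite J] (D : J → MvPolynomial σ ℝ) :
    ∃ p : σ → ℝ, ∀ j, D j ≠ 0 → MvPolynomial.eval p (D j) ≠ 0 := by
  classical
  have := Fintype.ofFinite J
  have hP0 : ∏ j, (if D j = 0 then 1 else D j) ≠ 0 :=
    Finset.prod_ne_zero_iff.2 fun j _ => by split_ifs with h <;> simp [h]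
  obtain ⟨p, hp⟩ : ∃ p : σ → ℝ, MvPolynomial.eval p (∏ j, (if D j = 0 then 1 else D j)) ≠ 0 := by
    by_contra! h
    exact hP0 (MvPolynomial.funext fun x => by rw [h x, map_zero])
  refine ⟨p, fun j hj => ?_⟩
  rw [map_prod] at hp
  have := Finset.prod_ne_zero_iff.1 hp j (Finset.mem_univ j)
  rwa [if_neg hj] at this

end GenericPoints

/-! ### Rows of the rigidity matrix and generic placements. -/

section RigidityRows

variable {V : Type*} [DecidableEq V] {d : ℕ}

/-- The row of the rigidity matrix that belongs to a pair of vertices. -/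
def rigidityRow (p : V → Fin d → ℝ) (e : Sym2 V) : V × Fin d → ℝ := fun x =>
  Sym2.lift ⟨fun u v =>
    (if x.1 = u then p u x.2 - p v x.2 else 0) + (if x.1 = v then p v x.2 - p u x.2 else 0),
    fun _ _ => add_comm _ _⟩ e

theorem rigidityRow_mk (p : V → Fin d → ℝ) (u v : V) (x : V × Fin d) :
    rigidityRow p s(u, v) x =
      (if x.1 = u then p u x.2 - p v x.2 else 0) + (if x.1 = v then p v x.2 - p u x.2 else 0) :=
  rfl

theorem rigidityMatrix_apply_eq_rigidityRow (G : SimpleGraph V) (p : V → Fin d → ℝ)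
    (e : G.edgeSet) : rigidityMatrix G p e = rigidityRow p e.1 := by
  obtain ⟨e, he⟩ := e
  induction e using Sym2.ind with
  | _ u v =>
    have huv : u ≠ v := G.ne_of_adj he
    funext x
    change (if x.1 = u then p u x.2 - p v x.2 else if x.1 = v then p v x.2 - p u x.2 else 0) =
      (if x.1 = u then p u x.2 - p v x.2 else 0) + (if x.1 = v then p v x.2 - p u x.2 else 0)
    by_cases h : x.1 = u
    · have : x.1 ≠ v := fun h' => huv (h.symm.trans h')
      simp [if_pos h, if_neg this]
    · simp [if_neg h]

theorem rigidityRow_eq_zero_of_notMem (p : V → Fin d → ℝ) {e : Sym2 V} {v : V} (h : v ∉ e)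
    (i : Fin d) : rigidityRow p e (v, i) = 0 := by
  induction e using Sym2.ind with
  | _ a b =>
    rw [Sym2.mem_iff, not_or] at h
    simp [rigidityRow_mk, h.1, h.2]

theorem rigidityRow_congr {p q : V → Fin d → ℝ} {e : Sym2 V} (h : ∀ v ∈ e, p v = q v) :
    rigidityRow p e = rigidityRow q e := by
  induction e using Sym2.ind with
  | _ a b =>
    funext x
    simp [rigidityRow_mk, h a (by simp), h b (by simp)]

/-- The dimension of the row space spanned by a set of pairs of vertices. -/
noncomputable def rigidityRank (p : V → Fin d → ℝ) (E : Set (Sym2 V)) : ℕ :=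
  Module.finrank ℝ (Submodule.span ℝ (rigidityRow p '' E))

theorem rank_rigidityMatrix [Fintype V] (G : SimpleGraph V) (p : V → Fin d → ℝ) :
    (rigidityMatrix G p).rank = rigidityRank p G.edgeSet := by
  have h : (rigidityMatrix G p).row = fun e : G.edgeSet => rigidityRow p e.1 :=
    funext fun e => rigidityMatrix_apply_eq_rigidityRow G p e
  rw [Matrix.rank_eq_finrank_span_row, rigidityRank, Set.image_eq_range, h]

theorem card_le_rigidityRank [Fintype V] {p : V → Fin d → ℝ} {I : Finset (Sym2 V)}
    {E : Set (Sym2 V)} (hI : LinearIndepOn ℝ (rigidityRow p) (I : Set (Sym2 V)))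
    (hIE : (I : Set (Sym2 V)) ⊆ E) : I.card ≤ rigidityRank p E := by
  have h1 := finrank_span_eq_card hI
  rw [← Set.toFinset_card, Finset.toFinset_coe] at h1
  rw [← h1, rigidityRank]
  apply Submodule.finrank_mono
  apply Submodule.span_mono
  rintro _ ⟨e, rfl⟩
  exact ⟨e, hIE e.2, rfl⟩

theorem exists_basis_rigidityRank [Fintype V] (p : V → Fin d → ℝ) (E : Set (Sym2 V)) :
    ∃ I : Finset (Sym2 V), (I : Set (Sym2 V)) ⊆ E ∧
      LinearIndepOn ℝ (rigidityRow p) (I : Set (Sym2 V)) ∧ I.card = rigidityRank p E := by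
  obtain ⟨b, hbE, -, hspan, hb⟩ :=
    exists_linearIndepOn_extension (linearIndepOn_empty ℝ (rigidityRow p)) (Set.empty_subset E)
  lift b to Finset (Sym2 V) using b.toFinite
  refine ⟨b, hbE, hb, (card_le_rigidityRank hb hbE).antisymm ?_⟩
  have h1 := finrank_span_eq_card hb
  rw [← Set.toFinset_card, Finset.toFinset_coe] at h1
  rw [← h1, rigidityRank]
  apply Submodule.finrank_mono
  rw [Submodule.span_le]
  refine hspan.trans (Submodule.span_mono ?_)
  rintro _ ⟨e, he, rfl⟩
  exact ⟨⟨e, he⟩, rfl⟩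

/-- A placement is generic if it makes every set of pairs independent that can be made so, and
if any `d` of the vectors from a vertex to other vertices are linearly independent. -/
structure IsGenericPlacement (p : V → Fin d → ℝ) : Prop where
  linearIndepOn_row : ∀ (I : Finset (Sym2 V)) (q : V → Fin d → ℝ),
    LinearIndepOn ℝ (rigidityRow q) (I : Set (Sym2 V)) →
    LinearIndepOn ℝ (rigidityRow p) (I : Set (Sym2 V))
  linearIndepOn_sub : ∀ (v : V) (U : Finset V), v ∉ U → U.card ≤ d →
    LinearIndepOn ℝ (fun u => p v - p u) (U : Set V)

open MvPolynomial in
theorem exists_isGenericPlacement [Fintype V] :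
    ∃ p : V → Fin d → ℝ, IsGenericPlacement p := by
  let R (e : Sym2 V) (x : V × Fin d) : MvPolynomial (V × Fin d) ℝ :=
    Sym2.lift ⟨fun u v =>
      (if x.1 = u then X (u, x.2) - X (v, x.2) else 0) +
      (if x.1 = v then X (v, x.2) - X (u, x.2) else 0), fun _ _ => add_comm _ _⟩ e
  have hR (q : V → Fin d → ℝ) (e : Sym2 V) (x : V × Fin d) :
      eval (Function.uncurry q) (R e x) = rigidityRow q e x := by
    induction e using Sym2.ind with
    | _ u v =>
      simp only [rigidityRow_mk, R, Sym2.lift_mk, map_add]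
      congr 1 <;> split_ifs <;> simp [Function.uncurry]
  choose D hD using fun I : Finset (Sym2 V) =>
    exists_polynomial_linearIndependent (fun (e : I) x => R e x)
  choose D' hD' using fun w : V × Finset V =>
    exists_polynomial_linearIndependent
      (fun (u : w.2) (i : Fin d) => (X (w.1, i) - X (u.1, i) : MvPolynomial (V × Fin d) ℝ))
  obtain ⟨p, hp⟩ := exists_common_eval_ne_zero (Sum.elim D D')
  obtain ⟨p, rfl⟩ : ∃ p' : V → Fin d → ℝ, p = Function.uncurry p' := ⟨Function.curry p, by simp⟩
  refine ⟨p, fun I q hq => ?_, fun v U hv hU => ?_⟩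
  · have h1 := (hD I (Function.uncurry q)).2 (by simp only [hR]; exact hq)
    have h2 := (hD I (Function.uncurry p)).1
      (hp (.inl I) fun h => h1 (by rw [show D I = 0 from h, map_zero]))
    simp only [hR] at h2
    exact h2
  · obtain ⟨f⟩ : Nonempty (U ↪ Fin d) := Function.Embedding.nonempty_of_card_le (by simpa using hU)
    -- One placement where the polynomial does not vanish: `v` at the origin and `U` at distinct
    -- negated basis vectors.
    let q : V → Fin d → ℝ := fun u => if h : u ∈ U then - Pi.single (f ⟨u, h⟩) 1 else 0
    suffices h1 : eval (Function.uncurry q) (D' (v, U)) ≠ 0 by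
      have h2 := (hD' (v, U) (Function.uncurry p)).1
        (hp (.inr (v, U)) fun h => h1 (by rw [show D' (v, U) = 0 from h, map_zero]))
      simp only [map_sub, eval_X, Function.uncurry] at h2
      exact h2
    rw [hD']
    simp only [map_sub, eval_X, Function.uncurry]
    have h2 : (fun (u : U) (i : Fin d) => q v i - q u i) =
        (fun u : U => Pi.basisFun ℝ (Fin d) (f u)) := by
      funext u i
      simp [q, hv]
    rw [h2]
    exact (Pi.basisFun ℝ (Fin d)).linearIndependent.comp f f.injective

end RigidityRows

/-! ### Counting estimates for random orderings. -/

section RandomOrder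

open Finset

variable {V : Type*} [DecidableEq V] {n : ℕ}

/-- All other counted elements precede the last counted one, which has at most `j` predecessors in
`A`. -/
theorem card_filter_card_lt_le (π : V ≃ Fin n) (A : Finset V) (j : ℕ) :
    #{w ∈ A | #{u ∈ A | π u < π w} ≤ j} ≤ j + 1 := by
  set B := {w ∈ A | #{u ∈ A | π u < π w} ≤ j} with hB
  rcases B.eq_empty_or_nonempty with h | h
  · simp [h]
  obtain ⟨b, hbB, hb⟩ := B.exists_max_image π h
  have hsub : B.erase b ⊆ {u ∈ A | π u < π b} := fun u hu => by
    rw [mem_erase] at hu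
    refine mem_filter.2 ⟨(mem_filter.1 hu.2).1, (hb u hu.2).lt_of_ne fun h => hu.1 (π.injective h)⟩
  have h1 := card_le_card hsub
  rw [card_erase_of_mem hbB] at h1
  have h2 := (mem_filter.1 hbB).2
  omega

/-- In a uniformly random ordering, an element of `A` is among the first `j + 1` elements of `A`
with probability at most `(j + 1) / |A|`. -/
theorem card_mul_card_orders_le [Fintype V] (A : Finset V) {v : V} (hv : v ∈ A) (j : ℕ) :
    #A * #{π : V ≃ Fin n | #{u ∈ A | π u < π v} ≤ j} ≤ (j + 1) * Fintype.card (V ≃ Fin n) := by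
  -- Exchanging `v` and `w` preserves `A`, so all its elements have the same count; summing over `w`
  -- and counting within each ordering gives the bound.
  have hswap : ∀ w ∈ A, #{π : V ≃ Fin n | #{u ∈ A | π u < π w} ≤ j} =
      #{π : V ≃ Fin n | #{u ∈ A | π u < π v} ≤ j} := fun w hw => by
    have key : ∀ π : V ≃ Fin n,
        #{u ∈ A | ((Equiv.swap v w).trans π) u < ((Equiv.swap v w).trans π) v} =
          #{u ∈ A | π u < π w} := fun π => by
      refine card_bij (fun u _ => Equiv.swap v w u) (fun u hu => ?_)
        (fun a _ b _ h => (Equiv.swap v w).injective h) fun u hu => ?_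
      · rw [mem_filter] at hu ⊢
        refine ⟨?_, by simpa using hu.2⟩
        rw [Equiv.swap_apply_def]; split_ifs <;> simp_all
      · rw [mem_filter] at hu
        refine ⟨Equiv.swap v w u, mem_filter.2 ⟨?_, by simpa using hu.2⟩, by simp⟩
        rw [Equiv.swap_apply_def]; split_ifs <;> simp_all
    refine card_bij (fun π _ => (Equiv.swap v w).trans π) (fun π hπ => ?_)
      (fun a _ b _ h => ?_) fun π hπ => ?_
    · rw [mem_filter] at hπ ⊢
      exact ⟨mem_univ _, (key π).trans_le hπ.2⟩
    · ext u
      simpa using congrArg (fun g : V ≃ Fin n => (g (Equiv.swap v w u)).val) h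
    · refine ⟨(Equiv.swap v w).trans π, ?_, ?_⟩
      · rw [mem_filter] at hπ ⊢
        refine ⟨mem_univ _, ?_⟩
        rw [← key]
        simpa [← Equiv.trans_assoc] using hπ.2
      · ext u; simp
  calc #A * #{π : V ≃ Fin n | #{u ∈ A | π u < π v} ≤ j}
      = ∑ w ∈ A, #{π : V ≃ Fin n | #{u ∈ A | π u < π w} ≤ j} := by
        rw [sum_congr rfl hswap, sum_const, smul_eq_mul]
    _ = ∑ π : V ≃ Fin n, #{w ∈ A | #{u ∈ A | π u < π w} ≤ j} := by
        simp only [card_filter _ A, card_filter _ univ]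
        rw [sum_comm]
    _ ≤ ∑ _π : V ≃ Fin n, (j + 1) := sum_le_sum fun π _ => card_filter_card_lt_le π A j
    _ = _ := by rw [sum_const, smul_eq_mul, mul_comm, card_univ]

/-- In a uniformly random ordering, the last of three elements is each of them with probability
at least `1 / 3`. -/
theorem card_orders_le_three_mul [Fintype V] {x y v : V} (hxy : x ≠ y) (hxv : x ≠ v) (hyv : y ≠ v) :
    Fintype.card (V ≃ Fin n) ≤ 3 * #{π : V ≃ Fin n | π x < π v ∧ π y < π v} := by
  have h := card_mul_card_orders_le (n := n) {x, y, v} (v := v) (by simp) 1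
  have h3 : #({x, y, v} : Finset V) = 3 := card_eq_three.2 ⟨x, y, v, hxy, hxv, hyv, rfl⟩
  -- If `v` is not last of the three, at most one of them precedes it; this has probability at most
  -- `2 / 3`.
  have hsub : ({π : V ≃ Fin n | ¬ (π x < π v ∧ π y < π v)} : Finset _) ⊆
      ({π : V ≃ Fin n | #{u ∈ ({x, y, v} : Finset V) | π u < π v} ≤ 1} : Finset _) := fun π hπ => by
    simp only [mem_filter, mem_univ, true_and] at hπ ⊢
    rw [card_le_one]
    intro a ha b hb
    simp only [mem_filter, mem_insert, mem_singleton] at ha hb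
    grind
  have h4 := card_le_card hsub
  have h5 := card_filter_add_card_filter_not (s := (univ : Finset (V ≃ Fin n)))
    (fun π => π x < π v ∧ π y < π v)
  rw [card_univ] at h5
  rw [h3] at h
  omega

end RandomOrder

/-! ### Rank gained by adding a vertex: 0-extensions and 1-extensions. -/

section VertexAddition

open Finset

/-- The edges of `G` with both ends in `S`. -/
def inducedEdges {V : Type*} (G : SimpleGraph V) (S : Finset V) : Set (Sym2 V) :=
  {e | e ∈ G.edgeSet ∧ ∀ v ∈ e, v ∈ S}

theorem inducedEdges_univ {V : Type*} [Fintype V] (G : SimpleGraph V) :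
    inducedEdges G univ = G.edgeSet := by
  simp [inducedEdges]

variable {V : Type*} [DecidableEq V] {d : ℕ}

/-- A criterion for the independence of a set of pairs together with a star at a new vertex. -/
theorem linearIndepOn_union_star {q : V → Fin d → ℝ} {I : Finset (Sym2 V)} {v : V} {W : Finset V}
    (hI : ∀ e ∈ I, v ∉ e) (hW : v ∉ W)
    (h : ∀ (g : Sym2 V → ℝ) (c : V → ℝ), ∑ w ∈ W, c w • (q v - q w) = 0 →
      ∑ e ∈ I, g e • rigidityRow q e + ∑ w ∈ W, c w • rigidityRow q s(v, w) = 0 →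
      (∀ e ∈ I, g e = 0) ∧ ∀ w ∈ W, c w = 0) :
    LinearIndepOn ℝ (rigidityRow q) (I ∪ W.image (fun w => s(v, w)) : Finset (Sym2 V)) := by
  rw [linearIndepOn_finset_iff]
  intro g hg
  have hdisj : Disjoint I (W.image fun w => s(v, w)) := by
    rw [disjoint_left]
    intro e he he'
    obtain ⟨w, -, rfl⟩ := mem_image.1 he'
    exact hI _ he (by simp)
  rw [sum_union hdisj, sum_image (fun a _ b _ hab => Sym2.congr_right.1 hab)] at hg
  -- Only the star rows are nonzero on the coordinates of `v`, so the dependency restricts to an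
  -- equilibrium there.
  have hv : ∑ w ∈ W, g s(v, w) • (q v - q w) = 0 := by
    funext i
    have := congrFun hg (v, i)
    simp only [Pi.add_apply, Finset.sum_apply, Pi.smul_apply, Pi.zero_apply] at this
    rw [sum_eq_zero fun e he => by rw [rigidityRow_eq_zero_of_notMem q (hI e he), smul_zero],
      zero_add] at this
    rw [Finset.sum_apply, Pi.zero_apply, ← this]
    refine sum_congr rfl fun w hw => ?_
    have : v ≠ w := fun h => hW (h ▸ hw)
    simp [rigidityRow_mk, this]
  obtain ⟨h1, h2⟩ := h g (fun w => g s(v, w)) hv hg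
  intro e he
  rcases mem_union.1 he with he | he
  · exact h1 e he
  · obtain ⟨w, hw, rfl⟩ := mem_image.1 he
    exact h2 w hw

/-- Independence at any placement `q` passes to the generic `p`, so the new vertex may be put in a
convenient special position. -/
theorem rigidityRank_add_card_le [Fintype V] {p q : V → Fin d → ℝ} (hp : IsGenericPlacement p)
    {G : SimpleGraph V} {S W : Finset V} {v : V} (hv : v ∉ S) (hWS : W ⊆ S)
    (hW : ∀ w ∈ W, G.Adj v w)
    (h : ∀ I : Finset (Sym2 V), (I : Set (Sym2 V)) ⊆ inducedEdges G S →
      LinearIndepOn ℝ (rigidityRow p) (I : Set (Sym2 V)) →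
      LinearIndepOn ℝ (rigidityRow q) (I ∪ W.image (fun w => s(v, w)) : Finset (Sym2 V))) :
    rigidityRank p (inducedEdges G S) + #W ≤ rigidityRank p (inducedEdges G (insert v S)) := by
  obtain ⟨I, hIE, hI, hcard⟩ := exists_basis_rigidityRank p (inducedEdges G S)
  have hdisj : Disjoint I (W.image fun w => s(v, w)) := by
    rw [disjoint_left]
    intro e he he'
    obtain ⟨w, -, rfl⟩ := mem_image.1 he'
    exact hv ((hIE he).2 v (by simp))
  have h2 := card_le_rigidityRank (E := inducedEdges G (insert v S))
    (hp.linearIndepOn_row _ q (h I hIE hI)) fun e he => by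
      rcases mem_union.1 (mem_coe.1 he) with he | he
      · exact ⟨(hIE he).1, fun u hu => mem_insert_of_mem ((hIE he).2 u hu)⟩
      · obtain ⟨w, hw, rfl⟩ := mem_image.1 he
        refine ⟨hW w hw, fun u hu => ?_⟩
        rcases Sym2.mem_iff.1 hu with rfl | rfl
        · exact mem_insert_self _ _
        · exact mem_insert_of_mem (hWS hw)
  rwa [card_union_of_disjoint hdisj, hcard,
    card_image_of_injective _ (fun a b hab => Sym2.congr_right.1 hab)] at h2

/-- Adding a vertex with at most `d` edges increases the rank by the number of these edges. -/
theorem rigidityRank_insert_of_card_le [Fintype V] {p : V → Fin d → ℝ} (hp : IsGenericPlacement p)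
    {G : SimpleGraph V} {S W : Finset V} {v : V} (hv : v ∉ S) (hWS : W ⊆ S)
    (hW : ∀ w ∈ W, G.Adj v w) (hWd : #W ≤ d) :
    rigidityRank p (inducedEdges G S) + #W ≤ rigidityRank p (inducedEdges G (insert v S)) := by
  have hvW : v ∉ W := fun h => hv (hWS h)
  refine rigidityRank_add_card_le (q := p) hp hv hWS hW fun I hIE hI =>
    linearIndepOn_union_star (fun e he h => hv ((hIE he).2 v h)) hvW fun g c hc hg => ?_
  have hc0 := linearIndepOn_finset_iff.1 (hp.linearIndepOn_sub v W hvW hWd) c hc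
  refine ⟨linearIndepOn_finset_iff.1 hI g ?_, hc0⟩
  rwa [sum_eq_zero (s := W) fun w hw => by rw [hc0 w hw, zero_smul], add_zero] at hg

/-- The `1`-extension: adding a vertex with `d + 1` edges, two of which go to a pair of vertices
whose row is not yet spanned, increases the rank by `d + 1`. -/
theorem rigidityRank_insert_of_notMem_span [Fintype V] {p : V → Fin d → ℝ}
    (hp : IsGenericPlacement p) {G : SimpleGraph V} {S W : Finset V} {v x y : V} (hv : v ∉ S)
    (hWS : W ⊆ S) (hW : ∀ w ∈ W, G.Adj v w) (hWd : #W = d + 1) (hx : x ∈ W) (hy : y ∈ W)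
    (hxy : x ≠ y)
    (hspan : rigidityRow p s(x, y) ∉ Submodule.span ℝ (rigidityRow p '' inducedEdges G S)) :
    rigidityRank p (inducedEdges G S) + (d + 1) ≤
      rigidityRank p (inducedEdges G (insert v S)) := by
  have hvW : v ∉ W := fun h => hv (hWS h)
  -- With `v` at the midpoint of `x` and `y`, the rows of `vx` and `vy` add up to half the row of
  -- `xy`.
  set z : Fin d → ℝ := (1 / 2 : ℝ) • (p x + p y) with hz
  set q : V → Fin d → ℝ := Function.update p v z with hq
  have hqv : q v = z := by simp [hq]
  have hqw : ∀ w, w ≠ v → q w = p w := fun w hw => by simp [hq, hw]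
  have hqW : ∀ w ∈ W, q w = p w := fun w hw => hqw w fun h => hvW (h ▸ hw)
  rw [← hWd]
  refine rigidityRank_add_card_le (q := q) hp hv hWS hW fun I hIE hI =>
    linearIndepOn_union_star (fun e he h => hv ((hIE he).2 v h)) hvW fun g c hc hg => ?_
  have hrowI : ∀ e ∈ I, rigidityRow q e = rigidityRow p e := fun e he =>
    rigidityRow_congr fun u hu => hqw u fun h => hv (h ▸ (hIE he).2 u hu)
  -- The equilibrium at `v` is rewritten through `q v - p w = (p y - p w) - (p y - p x) / 2`. The
  -- `d` vectors `p y - p w` are independent, which forces `c w = 0` off `x`, `y` and `c x = c y`.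
  have hlin := linearIndepOn_finset_iff.1
    (hp.linearIndepOn_sub y (W.erase y) (notMem_erase y W) (by rw [card_erase_of_mem hy]; omega))
    (fun w => if w = x then (c x - c y) / 2 - ∑ u ∈ (W.erase y).erase x, c u / 2 else c w)
  have hxe : x ∈ W.erase y := mem_erase.2 ⟨hxy, hx⟩
  have hsum : ∑ w ∈ W.erase y,
      (if w = x then (c x - c y) / 2 - ∑ u ∈ (W.erase y).erase x, c u / 2 else c w) •
        (p y - p w) = 0 := by
    have h1 : ∑ w ∈ (W.erase y).erase x,
        (if w = x then (c x - c y) / 2 - ∑ u ∈ (W.erase y).erase x, c u / 2 else c w) •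
          (p y - p w) = ∑ w ∈ (W.erase y).erase x, c w • (p y - p w) :=
      sum_congr rfl fun w hw => by rw [if_neg (ne_of_mem_erase hw)]
    have h2 : ∑ w ∈ (W.erase y).erase x, c w • (q v - q w) =
        ∑ w ∈ (W.erase y).erase x, c w • (p y - p w) -
          (∑ w ∈ (W.erase y).erase x, c w / 2) • (p y - p x) := by
      rw [sum_smul, ← sum_sub_distrib]
      refine sum_congr rfl fun w hw => ?_
      rw [hqv, hqW w (mem_of_mem_erase (mem_of_mem_erase hw)), hz]
      module
    rw [← hc, ← add_sum_erase W _ hy, ← add_sum_erase (W.erase y) _ hxe,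
      ← add_sum_erase (W.erase y) _ hxe, if_pos rfl, h1, h2, hqv, hqW x hx, hqW y hy, hz]
    module
  have hc' := hlin hsum
  have hc0 : ∀ w ∈ (W.erase y).erase x, c w = 0 := fun w hw => by
    have := hc' w (mem_of_mem_erase hw)
    rwa [if_neg (ne_of_mem_erase hw)] at this
  have hcxy : c x = c y := by
    have := hc' x hxe
    rw [if_pos rfl, sum_eq_zero fun w hw => by rw [hc0 w hw, zero_div]] at this
    linarith
  have hxyI : s(x, y) ∉ I := fun h => hspan (Submodule.subset_span ⟨_, hIE h, rfl⟩)
  have hJ : LinearIndepOn ℝ (rigidityRow p) (insert s(x, y) I : Finset (Sym2 V)) := by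
    rw [coe_insert, linearIndepOn_insert (by simpa using hxyI)]
    exact ⟨hI, fun h => hspan (Submodule.span_mono (Set.image_mono hIE) h)⟩
  -- The two surviving star rows, with equal coefficients, act as the row of `xy` with coefficient
  -- `c x / 2`.
  have hg' : ∑ e ∈ insert s(x, y) I,
      (if e = s(x, y) then c x / 2 else g e) • rigidityRow p e = 0 := by
    rw [sum_insert hxyI, if_pos rfl, ← hg, add_comm]
    congr 1
    · refine sum_congr rfl fun e he => ?_
      rw [if_neg (fun h : e = s(x, y) => hxyI (h ▸ he)), hrowI e he]
    · rw [← add_sum_erase W _ hy, ← add_sum_erase (W.erase y) _ hxe,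
        sum_eq_zero fun w hw => by rw [hc0 w hw, zero_smul], add_zero, ← hcxy]
      have hvx : v ≠ x := fun h => hvW (h ▸ hx)
      have hvy : v ≠ y := fun h => hvW (h ▸ hy)
      funext ⟨u, i⟩
      simp only [Pi.smul_apply, Pi.add_apply, rigidityRow_mk, hqv, hqW x hx, hqW y hy, smul_eq_mul,
        hz]
      by_cases h1 : u = v
      · subst h1; simp [hvx, hvy]; ring
      by_cases h2 : u = x
      · subst h2; simp [hxy, h1]; ring
      by_cases h3 : u = y
      · subst h3; simp [h2, h1]; ring
      simp [h1, h2, h3]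
  have hg0 := linearIndepOn_finset_iff.1 hJ _ hg'
  have hcx : c x = 0 := by
    have := hg0 s(x, y) (mem_insert_self _ _)
    rw [if_pos rfl] at this
    linarith
  refine ⟨fun e he => ?_, fun w hw => ?_⟩
  · have := hg0 e (mem_insert_of_mem he)
    rwa [if_neg (fun h : e = s(x, y) => hxyI (h ▸ he))] at this
  · by_cases h1 : w = x
    · rw [h1, hcx]
    by_cases h2 : w = y
    · rw [h2, ← hcxy, hcx]
    exact hc0 w (mem_erase.2 ⟨h1, mem_erase.2 ⟨h2, hw⟩⟩)

end VertexAddition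

/-! ### Infinitesimal isometries and the upper bound on the rank. -/

section TrivialMotions

open Finset

variable {V : Type*} {d : ℕ}

/-- The sign of an ordered pair of indices, which turns a function on unordered pairs into an
antisymmetric one. -/
noncomputable def pairSign (i j : Fin d) : ℝ := if i < j then 1 else if j < i then -1 else 0

theorem pairSign_swap (i j : Fin d) : pairSign j i = -pairSign i j := by
  unfold pairSign
  rcases lt_trichotomy i j with h | h | h
  · simp [h, h.not_gt]
  · simp [h]
  · simp [h, h.not_gt]

theorem pairSign_ne_zero {i j : Fin d} (h : i ≠ j) : pairSign i j ≠ 0 := by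
  unfold pairSign
  rcases lt_or_gt_of_ne h with h | h
  · simp [h]
  · simp [h, h.not_gt]

/-- The infinitesimal isometries of `ℝ^d`, evaluated at the points of a placement. The diagonal
pairs parametrize the translations, the others the rotations. -/
noncomputable def trivialMotion (p : V → Fin d → ℝ) :
    (Sym2 (Fin d) → ℝ) →ₗ[ℝ] (V × Fin d → ℝ) where
  toFun f x := f s(x.2, x.2) + ∑ j, pairSign x.2 j * f s(x.2, j) * p x.1 j
  map_add' f g := by
    funext x
    simp only [Pi.add_apply, mul_add, add_mul, sum_add_distrib]
    ring
  map_smul' c f := by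
    funext x
    simp only [Pi.smul_apply, smul_eq_mul, RingHom.id_apply, mul_add, mul_sum]
    congr 1
    exact sum_congr rfl fun j _ => by ring

theorem trivialMotion_apply (p : V → Fin d → ℝ) (f : Sym2 (Fin d) → ℝ) (v : V) (i : Fin d) :
    trivialMotion p f (v, i) = f s(i, i) + ∑ j, pairSign i j * f s(i, j) * p v j := rfl

/-- Translations cancel in the difference of the two ends; what is left is an antisymmetric form
evaluated at `(p u - p v, p u - p v)`. -/
theorem rigidityRow_dotProduct_trivialMotion [Fintype V] [DecidableEq V] (p : V → Fin d → ℝ) (e : Sym2 V)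
    (f : Sym2 (Fin d) → ℝ) : rigidityRow p e ⬝ᵥ trivialMotion p f = 0 := by
  induction e using Sym2.ind with
  | _ u v =>
    have h1 : rigidityRow p s(u, v) ⬝ᵥ trivialMotion p f =
        ∑ i, ∑ j, pairSign i j * f s(i, j) * (p u i - p v i) * (p u j - p v j) := by
      rw [dotProduct, Fintype.sum_prod_type_right]
      refine sum_congr rfl fun i _ => ?_
      simp only [rigidityRow_mk, add_mul, ite_mul, zero_mul, sum_add_distrib, sum_ite_eq', mem_univ,
        if_true, trivialMotion_apply]
      have : ∑ j, pairSign i j * f s(i, j) * (p u i - p v i) * (p u j - p v j) =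
          (p u i - p v i) * (∑ j, pairSign i j * f s(i, j) * p u j -
            ∑ j, pairSign i j * f s(i, j) * p v j) := by
        rw [← sum_sub_distrib, mul_sum]
        exact sum_congr rfl fun j _ => by ring
      rw [this]
      ring
    have h2 : ∑ i, ∑ j, pairSign i j * f s(i, j) * (p u i - p v i) * (p u j - p v j) =
        -∑ i, ∑ j, pairSign i j * f s(i, j) * (p u i - p v i) * (p u j - p v j) := by
      conv_lhs => rw [sum_comm]
      simp only [← sum_neg_distrib]
      refine sum_congr rfl fun i _ => sum_congr rfl fun j _ => ?_
      rw [pairSign_swap i j, Sym2.eq_swap (a := j)]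
      ring
    rw [h1]
    linarith

/-- A vanishing motion makes each row of its antisymmetric part vanish on the spanning vectors `p v
- p u`; so the rotation is zero, and then the translation. -/
theorem trivialMotion_injective {p : V → Fin d → ℝ} {v : V} {U : Finset V} (hU : #U = d)
    (hp : LinearIndepOn ℝ (fun u => p v - p u) (U : Set V)) :
    Function.Injective (trivialMotion p) := by
  rw [injective_iff_map_eq_zero]
  intro f hf
  have hspan : Submodule.span ℝ (Set.range fun u : (U : Set V) => p v - p u) = ⊤ :=
    LinearIndependent.span_eq_top_of_card_eq_finrank' hp (by simp [hU])
  have hzero : ∀ i j, pairSign i j * f s(i, j) = 0 := fun i j => by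
    let φ : (Fin d → ℝ) →ₗ[ℝ] ℝ :=
      ∑ j, (pairSign i j * f s(i, j)) • LinearMap.proj (R := ℝ) (φ := fun _ : Fin d => ℝ) j
    have hφ : ∀ x, φ x = ∑ j, pairSign i j * f s(i, j) * x j := fun x => by
      simp [φ, LinearMap.sum_apply]
    have hφ0 : φ = 0 := by
      apply LinearMap.ext_on_range hspan
      rintro ⟨u, hu⟩
      have h1 := congrFun hf (v, i)
      have h2 := congrFun hf (u, i)
      rw [trivialMotion_apply, Pi.zero_apply] at h1 h2
      rw [map_sub, hφ, hφ, LinearMap.zero_apply]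
      linarith
    have := hφ (Pi.single j 1)
    rw [hφ0] at this
    simpa [Pi.single_apply] using this.symm
  funext e
  induction e using Sym2.ind with
  | _ i j =>
    by_cases hij : i = j
    · subst hij
      have := congrFun hf (v, i)
      rw [trivialMotion_apply, sum_eq_zero fun j _ => by rw [hzero, zero_mul]] at this
      simpa using this
    · exact (mul_eq_zero.1 (hzero i j)).resolve_left (pairSign_ne_zero hij)

/-- The rank of the rigidity matrix is at most `d * |V| - (d + 1).choose 2` if the points affinely
span `ℝ^d`. -/
theorem rank_rigidityMatrix_add_choose_le [Fintype V] [DecidableEq V] (G : SimpleGraph V) {p : V → Fin d → ℝ}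
    {v : V} {U : Finset V} (hU : #U = d)
    (hp : LinearIndepOn ℝ (fun u => p v - p u) (U : Set V)) :
    (rigidityMatrix G p).rank + (d + 1).choose 2 ≤ d * Fintype.card V := by
  have h1 := LinearMap.finrank_range_add_finrank_ker (rigidityMatrix G p).mulVecLin
  have h2 : (d + 1).choose 2 ≤
      Module.finrank ℝ (LinearMap.ker (rigidityMatrix G p).mulVecLin) := by
    have h3 := LinearMap.finrank_le_finrank_of_injective
      (f := (trivialMotion p).codRestrict (LinearMap.ker (rigidityMatrix G p).mulVecLin) fun f => by
        rw [LinearMap.mem_ker, Matrix.mulVecLin_apply]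
        funext e
        rw [Matrix.mulVec, rigidityMatrix_apply_eq_rigidityRow]
        exact rigidityRow_dotProduct_trivialMotion p e f)
      (fun a b hab => trivialMotion_injective hU hp (congrArg Subtype.val hab))
    rwa [Module.finrank_fintype_fun_eq_card, Sym2.card, Fintype.card_fin] at h3
  rw [Module.finrank_fintype_fun_eq_card, Fintype.card_prod, Fintype.card_fin] at h1
  rw [Matrix.rank, mul_comm d]
  omega

end TrivialMotions

/-! ### Cliques and small cuts. -/

section HighConnectivity

open Finset

variable {V : Type*} [DecidableEq V] {d : ℕ}

theorem sum_range_sub_le_choose (d n : ℕ) : ∑ i ∈ range n, (d - i) ≤ (d + 1).choose 2 := by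
  induction d generalizing n with
  | zero => simp
  | succ d ih =>
    cases n with
    | zero => simp
    | succ n =>
      rw [sum_range_succ', Nat.choose_succ_succ' (d + 1) 1, Nat.choose_one_right]
      have := ih n
      simp only [Nat.add_sub_add_right, Nat.reduceAdd]
      omega

theorem rigidityRank_of_isClique [Fintype V] {p : V → Fin d → ℝ} (hp : IsGenericPlacement p)
    {G : SimpleGraph V} {S : Finset V} (hS : G.IsClique (S : Set V)) :
    d * #S ≤ rigidityRank p (inducedEdges G S) + (d + 1).choose 2 := by
  -- A vertex added to a clique on `i` vertices gains `min d i`; the shortfall from `d` per vertex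
  -- totals at most `d + (d - 1) + ... + 1`.
  have key : ∑ i ∈ range #S, min d i ≤ rigidityRank p (inducedEdges G S) := by
    induction S using Finset.induction_on with
    | empty => simp
    | insert v S hv ih =>
      have hcl : G.IsClique (S : Set V) := hS.subset (by simp)
      obtain ⟨W, hWS, hW⟩ := exists_subset_card_eq (min_le_right d #S)
      have := rigidityRank_insert_of_card_le hp (G := G) hv hWS
        (fun w hw => hS (by simp) (by simp [hWS hw]) fun h => hv (h ▸ hWS hw))
        (hW.trans_le (min_le_left _ _))
      rw [card_insert_of_notMem hv, sum_range_succ]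
      have := ih hcl
      omega
  have h1 := sum_range_sub_le_choose d #S
  have h2 : ∑ i ∈ range #S, min d i + ∑ i ∈ range #S, (d - i) = d * #S := by
    rw [← sum_add_distrib, sum_congr rfl fun i _ => show min d i + (d - i) = d by omega]
    simp [mul_comm]
  omega

/-- Every separation of the subgraph of `G` induced by `S` has order at least `k`. -/
def HasNoSmallCut (G : SimpleGraph V) (k : ℕ) (S : Finset V) : Prop :=
  ∀ A B : Finset V, A ⊆ S → B ⊆ S → A.Nonempty → B.Nonempty → Disjoint A B →
    #(S \ (A ∪ B)) < k → ∃ a ∈ A, ∃ b ∈ B, G.Adj a b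

theorem HasNoSmallCut.mono {G H : SimpleGraph V} {k : ℕ} {S : Finset V} (h : HasNoSmallCut G k S)
    (hGH : G ≤ H) : HasNoSmallCut H k S := fun A B hA hB hA' hB' hAB hk => by
  obtain ⟨a, ha, b, hb, hab⟩ := h A B hA hB hA' hB' hAB hk
  exact ⟨a, ha, b, hb, hGH hab⟩

/-- After deleting everything outside `A ∪ B`, a walk from `A` to `B` must leave `A` along an edge,
and it can only land in `B`. -/
theorem IsVertexConnected.hasNoSmallCut [Fintype V] {G : SimpleGraph V} {k : ℕ}
    (h : IsVertexConnected k G) : HasNoSmallCut G k univ := by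
  rintro A B - - ⟨a, ha⟩ ⟨b, hb⟩ hAB hk
  have hc := h.2 _ hk
  have hmem : ∀ c ∈ A ∪ B, c ∈ ((univ \ (A ∪ B) : Finset V) : Set V)ᶜ := fun c hc => by
    simpa [or_iff_not_imp_left] using mem_union.1 hc
  obtain ⟨w⟩ := hc.preconnected ⟨a, hmem a (mem_union_left _ ha)⟩ ⟨b, hmem b (mem_union_right _ hb)⟩
  obtain ⟨e, -, h1, h2⟩ := w.exists_boundary_dart {c | c.1 ∈ A} ha (disjoint_right.1 hAB hb)
  refine ⟨e.fst.1, h1, e.snd.1, ?_, e.adj⟩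
  have h3 := e.snd.2
  simp only [coe_sdiff, coe_univ, Set.mem_compl_iff, Set.mem_sdiff, Set.mem_univ, true_and,
    not_not, mem_coe, mem_union] at h3
  exact h3.resolve_left h2

/-- With fewer than `k` neighbours, they would separate `v` from its non-neighbours in `S`. -/
theorem HasNoSmallCut.le_card_neighbors {G : SimpleGraph V} [DecidableRel G.Adj] {k : ℕ}
    {S : Finset V} (h : HasNoSmallCut G k S) (hS : k < #S) {v : V} (hv : v ∈ S) :
    k ≤ #{u ∈ S | G.Adj v u} := by
  by_contra! hlt
  have hN : {u ∈ S | G.Adj v u} ⊆ S.erase v := fun u hu => by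
    rw [mem_filter] at hu
    exact mem_erase.2 ⟨hu.2.ne', hu.1⟩
  have hcard : #(S.erase v \ {u ∈ S | G.Adj v u}) + #{u ∈ S | G.Adj v u} = #S - 1 := by
    rw [card_sdiff_add_card_eq_card hN, card_erase_of_mem hv]
  obtain ⟨a, ha, b, hb, hab⟩ := h {v} (S.erase v \ {u ∈ S | G.Adj v u}) (by simpa using hv)
    (sdiff_subset.trans (erase_subset _ _)) ⟨v, by simp⟩ (card_pos.1 (by omega)) (by simp)
    (lt_of_le_of_lt (card_le_card fun u hu => by
      simp only [mem_sdiff, mem_union, mem_singleton, mem_erase, mem_filter] at hu ⊢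
      tauto) hlt)
  rw [mem_singleton] at ha
  subst ha
  simp only [mem_sdiff, mem_erase, mem_filter] at hb
  exact hb.2 ⟨hb.1.2, hab⟩

theorem HasNoSmallCut.isClique {G : SimpleGraph V} {k : ℕ} {S : Finset V}
    (h : HasNoSmallCut G k S) (hS : #S ≤ k + 1) : G.IsClique (S : Set V) := by
  intro x hx y hy hxy
  have hsub : ({x} ∪ {y} : Finset V) ⊆ S := by
    intro z hz
    simp only [mem_union, mem_singleton] at hz
    rcases hz with rfl | rfl <;> assumption
  have hcard : #({x} ∪ {y} : Finset V) = 2 := card_pair hxy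
  have h1 := card_sdiff_add_card_eq_card hsub
  obtain ⟨a, ha, b, hb, hab⟩ := h {x} {y} (by simpa using hx) (by simpa using hy) (by simp)
    (by simp) (by simpa using hxy) (by omega)
  rw [mem_singleton] at ha hb
  subst ha hb
  exact hab

/-- Deleting a vertex whose neighbourhood is a clique creates no new separations. -/
theorem HasNoSmallCut.erase {G : SimpleGraph V} {k : ℕ} {S : Finset V} (h : HasNoSmallCut G k S)
    {v : V} (hv : v ∈ S)
    (hcl : ∀ x ∈ S, ∀ y ∈ S, G.Adj v x → G.Adj v y → x ≠ y → G.Adj x y) :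
    HasNoSmallCut G k (S.erase v) := by
  intro A B hA hB hA' hB' hAB hk
  by_contra! hno
  have hAS := hA.trans (erase_subset v S)
  have hBS := hB.trans (erase_subset v S)
  have hvA : v ∉ A := fun h => notMem_erase v S (hA h)
  have hvB : v ∉ B := fun h => notMem_erase v S (hB h)
  -- Adding `v` to either side gives a separation of `S` of the same order, so `v` has a neighbour
  -- in `B` and one in `A`; these are adjacent by the clique hypothesis.
  obtain ⟨a, ha, b, hb, hab⟩ := h (insert v A) B (insert_subset hv hAS) hBS (by simp) hB'
    (by simp [hvB, hAB]) (lt_of_le_of_lt (card_le_card fun u hu => by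
      simp only [mem_sdiff, mem_union, mem_insert, mem_erase] at hu ⊢
      tauto) hk)
  obtain rfl : a = v := (mem_insert.1 ha).resolve_right fun ha => hno a ha b hb hab
  obtain ⟨a', ha', b', hb', hab'⟩ := h A (insert a B) hAS (insert_subset hv hBS) hA' (by simp)
    (by simp [hvA, hAB]) (lt_of_le_of_lt (card_le_card fun u hu => by
      simp only [mem_sdiff, mem_union, mem_insert, mem_erase] at hu ⊢
      tauto) hk)
  obtain rfl : b' = a := (mem_insert.1 hb').resolve_right fun hb' => hno a' ha' b' hb' hab'
  exact hno a' ha' b hb (hcl a' (hAS ha') b (hBS hb) hab'.symm hab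
    fun h => disjoint_left.1 hAB ha' (h ▸ hb))

/-! ### Closed graphs and the random-order rank bound. -/

/-- A graph is closed in a placement if its row space contains no further rows. -/
def IsClosedInPlacement (G : SimpleGraph V) (p : V → Fin d → ℝ) : Prop :=
  ∀ x y, x ≠ y → ¬ G.Adj x y →
    rigidityRow p s(x, y) ∉ Submodule.span ℝ (rigidityRow p '' G.edgeSet)

/-- Every graph is contained in a closed graph with the same rank. -/
theorem exists_isClosedInPlacement (G : SimpleGraph V) (p : V → Fin d → ℝ) :
    ∃ H : SimpleGraph V, G ≤ H ∧ IsClosedInPlacement H p ∧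
      rigidityRank p H.edgeSet = rigidityRank p G.edgeSet := by
  let H : SimpleGraph V :=
    { Adj := fun x y => x ≠ y ∧
        rigidityRow p s(x, y) ∈ Submodule.span ℝ (rigidityRow p '' G.edgeSet)
      symm := ⟨fun x y h => ⟨h.1.symm, by rw [Sym2.eq_swap]; exact h.2⟩⟩
      loopless := ⟨fun x h => h.1 rfl⟩ }
  have hGH : G ≤ H := fun x y h => ⟨h.ne, Submodule.subset_span ⟨_, h, rfl⟩⟩
  have hspan : Submodule.span ℝ (rigidityRow p '' H.edgeSet) =
      Submodule.span ℝ (rigidityRow p '' G.edgeSet) := by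
    apply le_antisymm
    · rw [Submodule.span_le]
      rintro _ ⟨e, he, rfl⟩
      induction e using Sym2.ind with
      | _ x y => exact he.2
    · exact Submodule.span_mono (Set.image_mono (SimpleGraph.edgeSet_mono hGH))
  refine ⟨H, hGH, fun x y hxy h h' => h ⟨hxy, hspan ▸ h'⟩, ?_⟩
  rw [rigidityRank, hspan, rigidityRank]

/-- The gain in rank from adding `v` to `T`, for two non-adjacent neighbours `x`, `y` of `v`. -/
theorem rigidityRank_insert_ge [Fintype V] (hd : 1 ≤ d) {p : V → Fin d → ℝ}
    (hp : IsGenericPlacement p) {G : SimpleGraph V} [DecidableRel G.Adj]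
    (hG : IsClosedInPlacement G p) {T : Finset V} {v x y : V} (hv : v ∉ T) (hx : G.Adj v x)
    (hy : G.Adj v y) (hxy : x ≠ y) (hnadj : ¬ G.Adj x y) :
    (rigidityRank p (inducedEdges G T) : ℤ) + (d + (if x ∈ T ∧ y ∈ T then 1 else 0)
      - (d + 1) * (if #{u ∈ T | G.Adj v u} ≤ d then 1 else 0)) ≤
      rigidityRank p (inducedEdges G (insert v T)) := by
  have hadj : ∀ W : Finset V, W ⊆ {u ∈ T | G.Adj v u} → ∀ w ∈ W, G.Adj v w :=
    fun W hW w hw => (mem_filter.1 (hW hw)).2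
  by_cases hdeg : #{u ∈ T | G.Adj v u} ≤ d
  -- With at most `d` earlier neighbours the claimed gain is at most `0`, so monotonicity of the
  -- rank suffices.
  · have h0 := rigidityRank_insert_of_card_le hp (G := G) (W := ∅) hv (by simp) (by simp) (by simp)
    rw [card_empty, add_zero] at h0
    rw [if_pos hdeg]
    split_ifs <;> omega
  rw [if_neg hdeg]
  push Not at hdeg
  by_cases hT : x ∈ T ∧ y ∈ T
  · obtain ⟨W, hxyW, hWT, hW⟩ := exists_subsuperset_card_eq
      (s := {x, y}) (t := {u ∈ T | G.Adj v u}) (n := d + 1)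
      (by
        intro z hz
        rw [mem_insert, mem_singleton] at hz
        rcases hz with rfl | rfl <;> simp [*])
      (by rw [card_pair hxy]; omega) hdeg
    have := rigidityRank_insert_of_notMem_span hp (G := G) hv (hWT.trans (filter_subset _ _))
      (hadj W hWT) hW (hxyW (by simp)) (hxyW (by simp)) hxy fun h => hG x y hxy hnadj
        (Submodule.span_mono (Set.image_mono fun e he => he.1) h)
    rw [if_pos hT]
    omega
  · obtain ⟨W, hWT, hW⟩ := exists_subset_card_eq hdeg.le
    have := rigidityRank_insert_of_card_le hp (G := G) hv (hWT.trans (filter_subset _ _))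
      (hadj W hWT) hW.le
    rw [if_neg hT]
    omega

/-- Averages the total gain over all orderings of the vertices: the rank bounds it in each ordering,
and each vertex contributes at least `d` on average. -/
theorem rigidityRank_of_no_simplicial [Fintype V] (hd : 1 ≤ d) {p : V → Fin d → ℝ}
    (hp : IsGenericPlacement p) {G : SimpleGraph V} [DecidableRel G.Adj]
    (hG : IsClosedInPlacement G p) {S : Finset V}
    (hdeg : ∀ v ∈ S, 3 * (d + 1) ^ 2 ≤ #{u ∈ S | G.Adj v u} + 1)
    (hS : ∀ v ∈ S, ∃ x ∈ S, ∃ y ∈ S, G.Adj v x ∧ G.Adj v y ∧ x ≠ y ∧ ¬ G.Adj x y) :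
    d * #S ≤ rigidityRank p (inducedEdges G S) := by
  choose! x hxS y hyS hx hy hxy hnadj using hS
  set n := Fintype.card V
  let gain (π : V ≃ Fin n) (T : Finset V) (v : V) : ℤ :=
    d + (if x v ∈ ({u ∈ T | π u < π v} : Finset V) ∧ y v ∈ ({u ∈ T | π u < π v} : Finset V)
      then 1 else 0)
      - (d + 1) * (if #{u ∈ ({u ∈ T | π u < π v} : Finset V) | G.Adj v u} ≤ d then 1 else 0)
  have horder : ∀ (π : V ≃ Fin n) (T : Finset V), T ⊆ S →
      ∑ v ∈ T, gain π T v ≤ rigidityRank p (inducedEdges G T) := by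
    intro π T
    induction T using Finset.induction_on_max_value π with
    | empty => simp
    | insert a T ha hmax ih =>
      intro hTS
      have haS : a ∈ S := hTS (mem_insert_self _ _)
      have hlt : ∀ u ∈ T, π u < π a := fun u hu =>
        (hmax u hu).lt_of_ne fun h => ha (π.injective h ▸ hu)
      have hfa : ({u ∈ insert a T | π u < π a} : Finset V) = T := by
        ext u
        simp only [mem_filter, mem_insert]
        constructor
        · rintro ⟨rfl | h, h'⟩
          · exact absurd h' (lt_irrefl _)
          · exact h
        · exact fun h => ⟨.inr h, hlt u h⟩
      have hfv : ∀ v ∈ T, ({u ∈ insert a T | π u < π v} : Finset V) = {u ∈ T | π u < π v} :=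
        fun v hv => by rw [filter_insert, if_neg (hlt v hv).not_gt]
      have h1 : ∑ v ∈ T, gain π (insert a T) v = ∑ v ∈ T, gain π T v :=
        sum_congr rfl fun v hv => by simp only [gain, hfv v hv]
      have h2 := rigidityRank_insert_ge hd hp hG ha (hx a haS) (hy a haS) (hxy a haS) (hnadj a haS)
      have h3 : gain π (insert a T) a = d + (if x a ∈ T ∧ y a ∈ T then 1 else 0)
          - (d + 1) * (if #{u ∈ T | G.Adj a u} ≤ d then 1 else 0) := by
        simp only [gain, hfa]
      rw [sum_insert ha, h1, h3]
      have := ih ((subset_insert _ _).trans hTS)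
      omega
  have hgain : ∀ v ∈ S, (d : ℤ) * Fintype.card (V ≃ Fin n) ≤ ∑ π : V ≃ Fin n, gain π S v := by
    intro v hv
    -- At most `d` earlier neighbours means that `v` is among the first `d + 1` of its closed
    -- neighbourhood.
    have hA := card_mul_card_orders_le (n := n) (insert v {u ∈ S | G.Adj v u}) (v := v)
      (mem_insert_self _ _) d
    have hB := card_orders_le_three_mul (n := n) (hxy v hv) (hx v hv).ne' (hy v hv).ne'
    rw [card_insert_of_notMem (by simp)] at hA
    have e1 : ∀ π : V ≃ Fin n, ({u ∈ insert v {u ∈ S | G.Adj v u} | π u < π v} : Finset V) =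
        {u ∈ ({u ∈ S | π u < π v} : Finset V) | G.Adj v u} := fun π => by
      ext u
      simp only [mem_filter, mem_insert]
      constructor
      · rintro ⟨rfl | h, h'⟩
        · exact absurd h' (lt_irrefl _)
        · exact ⟨⟨h.1, h'⟩, h.2⟩
      · exact fun h => ⟨.inr ⟨h.1.1, h.2⟩, h.1.2⟩
    simp only [e1] at hA
    have e2 : ∑ π : V ≃ Fin n, gain π S v = d * Fintype.card (V ≃ Fin n) +
        #{π : V ≃ Fin n | π (x v) < π v ∧ π (y v) < π v} - (d + 1) *
        #{π : V ≃ Fin n | #{u ∈ ({u ∈ S | π u < π v} : Finset V) | G.Adj v u} ≤ d} := by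
      simp only [gain, sum_sub_distrib, sum_add_distrib, ← mul_sum, sum_boole, sum_const,
        card_univ, mem_filter, hxS v hv, hyS v hv, true_and]
      simp [mul_comm]
    rw [e2]
    set a := #{π : V ≃ Fin n | #{u ∈ ({u ∈ S | π u < π v} : Finset V) | G.Adj v u} ≤ d}
    -- Cancelling `d + 1` bounds the expected penalty by `1 / 3`, which the expected bonus covers.
    have h1 : (d + 1) * (3 * ((d + 1) * a)) ≤ (d + 1) * Fintype.card (V ≃ Fin n) :=
      le_trans (by
        calc (d + 1) * (3 * ((d + 1) * a)) = 3 * (d + 1) ^ 2 * a := by ring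
          _ ≤ _ := Nat.mul_le_mul_right a (hdeg v hv)) hA
    have h2 := Nat.le_of_mul_le_mul_left h1 (Nat.succ_pos d)
    have h3 : (d + 1) * a ≤ #{π : V ≃ Fin n | π (x v) < π v ∧ π (y v) < π v} := by omega
    have h4 : ((d : ℤ) + 1) * a ≤ #{π : V ≃ Fin n | π (x v) < π v ∧ π (y v) < π v} := by
      exact_mod_cast h3
    linarith
  have hN : 0 < (Fintype.card (V ≃ Fin n) : ℤ) :=
    Int.natCast_pos.2 (Fintype.card_pos_iff.2 ⟨Fintype.equivFin V⟩)
  have hfin : (Fintype.card (V ≃ Fin n) : ℤ) * (d * #S) ≤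
      Fintype.card (V ≃ Fin n) * rigidityRank p (inducedEdges G S) :=
    calc (Fintype.card (V ≃ Fin n) : ℤ) * (d * #S)
        = ∑ v ∈ S, (d : ℤ) * Fintype.card (V ≃ Fin n) := by
          rw [sum_const, nsmul_eq_mul]; ring
      _ ≤ ∑ v ∈ S, ∑ π : V ≃ Fin n, gain π S v := sum_le_sum hgain
      _ = ∑ π : V ≃ Fin n, ∑ v ∈ S, gain π S v := sum_comm
      _ ≤ ∑ _π : V ≃ Fin n, (rigidityRank p (inducedEdges G S) : ℤ) :=
          sum_le_sum fun π _ => horder π S Subset.rfl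
      _ = _ := by rw [sum_const, nsmul_eq_mul, card_univ]
  exact_mod_cast le_of_mul_le_mul_left hfin hN

theorem le_rigidityRank_of_hasNoSmallCut [Fintype V] (hd : 1 ≤ d) {p : V → Fin d → ℝ}
    (hp : IsGenericPlacement p) {G : SimpleGraph V} (hG : IsClosedInPlacement G p) {k : ℕ}
    (hk : 3 * (d + 1) ^ 2 ≤ k + 1) (S : Finset V) (hS : k < #S) (hcut : HasNoSmallCut G k S) :
    d * #S ≤ rigidityRank p (inducedEdges G S) + (d + 1).choose 2 := by
  classical
  induction S using Finset.strongInduction with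
  | H S ih =>
    by_cases hcl : G.IsClique (S : Set V)
    · exact rigidityRank_of_isClique hp hcl
    have hS' : k + 1 < #S := by
      by_contra! h
      exact hcl (hcut.isClique h)
    have hdeg : ∀ v ∈ S, k ≤ #{u ∈ S | G.Adj v u} := fun v hv => hcut.le_card_neighbors hS hv
    by_cases hsimp : ∀ v ∈ S, ∃ x ∈ S, ∃ y ∈ S, G.Adj v x ∧ G.Adj v y ∧ x ≠ y ∧ ¬ G.Adj x y
    · have := rigidityRank_of_no_simplicial hd hp hG
        (fun v hv => hk.trans (Nat.succ_le_succ (hdeg v hv))) hsimp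
      omega
    · push Not at hsimp
      obtain ⟨v, hv, hvcl⟩ := hsimp
      -- A non-clique has more than `k + 1` vertices, so the size condition survives the removal of
      -- `v`.
      have h1 := ih (S.erase v) (erase_ssubset hv) (by rw [card_erase_of_mem hv]; omega)
        (hcut.erase hv hvcl)
      have hdk : d ≤ k := by nlinarith
      obtain ⟨W, hWS, hW⟩ := exists_subset_card_eq (hdk.trans (hdeg v hv))
      have h2 := rigidityRank_insert_of_card_le hp (G := G) (S := S.erase v) (notMem_erase v S)
        (fun w hw => by
          have := mem_filter.1 (hWS hw)
          exact mem_erase.2 ⟨this.2.ne', this.1⟩)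
        (fun w hw => (mem_filter.1 (hWS hw)).2) hW.le
      rw [insert_erase hv, hW] at h2
      have h3 : d * #S = d * #(S.erase v) + d := by
        rw [← card_erase_add_one hv]; ring
      omega

theorem IsVertexConnected.isRigidInDim [Fintype V] (hd : 1 ≤ d) {G : SimpleGraph V} {k : ℕ}
    (hk : 3 * (d + 1) ^ 2 ≤ k + 1) (h : IsVertexConnected k G) (hV : d + 1 ≤ Fintype.card V) :
    IsRigidInDim d G := by
  obtain ⟨p, hp⟩ := exists_isGenericPlacement (V := V) (d := d)
  refine ⟨p, fun u v huv => ?_, ?_⟩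
  · by_contra hne
    have := (hp.linearIndepOn_sub u {v} (by simpa using hne) (by simpa using hd)).ne_zero
      (mem_coe.2 (mem_singleton_self v))
    exact this (by simp [huv])
  · obtain ⟨H, hGH, hH, hrank⟩ := exists_isClosedInPlacement G p
    have hlow := le_rigidityRank_of_hasNoSmallCut hd hp hH hk univ (by simpa using h.1)
      (h.hasNoSmallCut.mono hGH)
    rw [inducedEdges_univ, hrank, ← rank_rigidityMatrix, card_univ] at hlow
    obtain ⟨v⟩ : Nonempty V := Fintype.card_pos_iff.1 (by omega)
    obtain ⟨U, hU, hUd⟩ := exists_subset_card_eq (s := univ.erase v) (n := d)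
      (by rw [card_erase_of_mem (mem_univ v), card_univ]; omega)
    have hup := rank_rigidityMatrix_add_choose_le G hUd
      (hp.linearIndepOn_sub v U (fun h => notMem_erase v univ (hU h)) hUd.le)
    exact hup.antisymm hlow

end HighConnectivity

/-! ### The stated bound. -/

theorem theorem1p3 :
    ∃ C : ℝ, 0 < C ∧
      ∀ (d : ℕ), 1 ≤ d →
      ∀ (V : Type*) [Fintype V] [DecidableEq V] (G : SimpleGraph V),
        d + 1 ≤ Fintype.card V →
        ∀ k : ℕ, C * (d : ℝ) ^ 2 * Real.log (Fintype.card V : ℝ) ^ 2 ≤ (k : ℝ) →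
          IsVertexConnected k G →
            IsRigidInDim d G := by
  -- There are at least two vertices, so the logarithm is at least `1 / 2` and `48 / 4 = 12`;
  -- finally `3 * (d + 1) ^ 2 ≤ 12 * d ^ 2` as `d ≥ 1`.
  refine ⟨48, by norm_num, fun d hd V _ _ G hV k hk h => h.isRigidInDim hd ?_ hV⟩
  have hd' : (1 : ℝ) ≤ d := by exact_mod_cast hd
  have hlog : 1 / 2 ≤ Real.log (Fintype.card V : ℝ) := by
    have h2 : (2 : ℝ) ≤ Fintype.card V := by exact_mod_cast (by omega : 2 ≤ Fintype.card V)
    have := Real.log_le_log (by norm_num) h2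
    have := Real.log_two_gt_d9
    linarith
  have h1 : (12 : ℝ) * d ^ 2 ≤ k := by
    have h4 : (1 / 4 : ℝ) ≤ Real.log (Fintype.card V : ℝ) ^ 2 := by nlinarith
    have := mul_le_mul_of_nonneg_left h4 (by positivity : (0 : ℝ) ≤ 48 * (d : ℝ) ^ 2)
    linarith
  have h2 : 12 * d ^ 2 ≤ k := by exact_mod_cast h1
  nlinarith
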